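/- A permutation $\sigma$ of length $k$ is contained in a permutation $\pi$ of length $n$ if there are indices $1\le i_1<\dots<i_k\le n$ such that $\pi(i_1)\cdots\pi(i_k)$ is order isomorphic to $\sigma$ (the empty permutation is allowed). A permutation class is a set of finite permutations closed downward under containment. For a quasi-order $(L,\le_L)$, an $L$-labeled permutation is a pair $(\pi,\ell_\pi)$ with $\ell_\pi:\{1,\dots,n\}\to L$, where $n$ is the length of $\pi$; we put $(\sigma,\ell_\sigma)\le(\pi,\ell_\pi)$ if the indices above can be chosen so that in addition $\ell_\sigma(j)\le_L\ell_\pi(i_j)$ for all $1\le j\le k$. An $L$-labeled graph is a pair $(G,\ell_G)$ of a finite simple graph $G$ and a map $\ell_G:V(G)\to L$; we put $(H,\ell_H)\le(G,\ell_G)$ if there is an isomorphism $f$ from $H$ onto an induced subgraph of $G$ with $\ell_H(v)\le_L\ell_G(f(v))$ for all $v\in V(H)$. A quasi-order is a well-quasi-order (wqo) if every infinite sequence $x_1,x_2,\dots$ of its elements has indices $i<j$ with $x_i\le x_j$. A set of permutations (respectively, of finite graphs) is labeled well-quasi-ordered (lwqo) if, for every wqo $(L,\le_L)$, the $L$-labeled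 members of the set are wqo under the order just defined. The inversion graph $G_\pi$ of a permutation $\pi$ of length $n$ has vertex set $\{1,\dots,n\}$, with $i$ and $j$, $i<j$, adjacent if and only if $\pi(i)>\pi(j)$. For a permutation class $\mathcal C$, let $G_{\mathcal C}$ be the class of all graphs isomorphic to $G_\pi$ for some $\pi\in\mathcal C$. **Theorem.** A permutation class $\mathcal C$ is lwqo if and only if the corresponding class $G_{\mathcal C}$ of inversion graphs is lwqo. -/

import Mathlib

universe u

/-- A finite permutation: a length `n` together with a permutation of `Fin n`,
the entry in position `i` being `toEquiv i`. The empty permutation (`n = 0`) is included. -/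
structure FinPerm where
  length : ℕ
  toEquiv : Equiv.Perm (Fin length)

/-- An occurrence of `σ` in `π`: an increasing sequence `f 0 < f 1 < ⋯` of indices of `π` such that
the corresponding subsequence of entries of `π` is order isomorphic to `σ`. -/
def FinPerm.IsOccurrence (σ π : FinPerm) (f : Fin σ.length → Fin π.length) : Prop :=
  StrictMono f ∧ ∀ i j, π.toEquiv (f i) < π.toEquiv (f j) ↔ σ.toEquiv i < σ.toEquiv j

theorem FinPerm.IsOccurrence.id (σ : FinPerm) : σ.IsOccurrence σ (fun i => i) :=
  ⟨fun _ _ h => h, fun _ _ => Iff.rfl⟩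

theorem FinPerm.IsOccurrence.comp {ρ σ π : FinPerm} {g : Fin σ.length → Fin π.length}
    {f : Fin ρ.length → Fin σ.length} (hg : σ.IsOccurrence π g) (hf : ρ.IsOccurrence σ f) :
    ρ.IsOccurrence π (fun i => g (f i)) :=
  ⟨fun _ _ h => hg.1 (hf.1 h), fun i j => (hg.2 (f i) (f j)).trans (hf.2 i j)⟩

/-- The containment order on permutations. -/
instance FinPerm.instPreorder : Preorder FinPerm where
  le σ π := ∃ f, σ.IsOccurrence π f
  le_refl σ := ⟨_, .id σ⟩
  le_trans _ _ _ := fun ⟨_, hf⟩ ⟨_, hg⟩ => ⟨_, hg.comp hf⟩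

/-- An `L`-labeled permutation. -/
structure LabeledPerm (L : Type u) where
  perm : FinPerm
  label : Fin perm.length → L

/-- The labeled containment order: there is an occurrence of the smaller permutation in the larger
one along which labels do not decrease. -/
instance LabeledPerm.instPreorder (L : Type u) [Preorder L] : Preorder (LabeledPerm L) where
  le s p := ∃ f, s.perm.IsOccurrence p.perm f ∧ ∀ j, s.label j ≤ p.label (f j)
  le_refl s := ⟨_, .id s.perm, fun _ => le_rfl⟩
  le_trans _ _ _ := fun ⟨f, hf, hf'⟩ ⟨_, hg, hg'⟩ =>
    ⟨_, hg.comp hf, fun j => (hf' j).trans (hg' (f j))⟩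

/-- A finite simple graph. -/
structure FinGraph where
  V : Type
  finite : Finite V
  graph : SimpleGraph V

/-- An `L`-labeled finite graph. -/
structure LabeledGraph (L : Type u) where
  toFinGraph : FinGraph
  label : toFinGraph.V → L

/-- The labeled induced subgraph order: there is an isomorphism from the smaller graph onto an
induced subgraph of the larger one along which labels do not decrease. -/
instance LabeledGraph.instPreorder (L : Type u) [Preorder L] : Preorder (LabeledGraph L) where
  le H G := ∃ f : H.toFinGraph.graph ↪g G.toFinGraph.graph, ∀ v, H.label v ≤ G.label (f v)
  le_refl _ := ⟨.refl, fun _ => le_rfl⟩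
  le_trans _ _ _ := fun ⟨f, hf⟩ ⟨g, hg⟩ => ⟨f.trans g, fun v => (hf v).trans (hg (f v))⟩

/-- The inversion graph of `π`: two indices are adjacent exactly when their entries form an
inversion. -/
def FinPerm.inversionGraph (π : FinPerm) : SimpleGraph (Fin π.length) where
  Adj i j := (i < j ∧ π.toEquiv j < π.toEquiv i) ∨ (j < i ∧ π.toEquiv i < π.toEquiv j)
  symm := ⟨fun _ _ h => h.symm⟩
  loopless := ⟨fun i h => h.elim (fun h => lt_irrefl i h.1) (fun h => lt_irrefl i h.1)⟩

/-- The class of all finite graphs isomorphic to the inversion graph of some member of `C`. -/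
def inversionGraphClass (C : Set FinPerm) : Set FinGraph :=
  {H | ∃ π ∈ C, Nonempty (H.graph ≃g π.inversionGraph)}

/-- A set `C` of permutations is labeled well-quasi-ordered if, for every well-quasi-order `L`,
the set of `L`-labeled members of `C` is well-quasi-ordered by labeled containment
(every infinite sequence has a good pair, which is what `Set.IsPWO` says). -/
def PermLWQO (C : Set FinPerm) : Prop :=
  ∀ (L : Type u) [Preorder L] [WellQuasiOrderedLE L], {p : LabeledPerm L | p.perm ∈ C}.IsPWO

/-- A set `D` of finite graphs is labeled well-quasi-ordered if, for every well-quasi-order `L`,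
the set of `L`-labeled members of `D` is well-quasi-ordered by the labeled induced subgraph
order. -/
def GraphLWQO (D : Set FinGraph) : Prop :=
  ∀ (L : Type u) [Preorder L] [WellQuasiOrderedLE L],
    {G : LabeledGraph L | G.toFinGraph ∈ D}.IsPWO

/-! An occurrence of permutations is an embedding of inversion graphs, so one implication is
immediate. The converse must recover an occurrence from a graph embedding, although different
permutations may share a graph. For simple permutations the ambiguity is small, as in Gallai's
theory: an embedding preserves or reverses all edges at once, and likewise all non-edges
(`IsSimpleRel.lt_of_lt`). Indeed, colour pairs as non-edges, preserved edges and reversed edges. No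
triangle is rainbow, so some colour is disconnected, and if all three colours occur, a component of
it is a nontrivial proper interval. Marking the ends of one edge and one non-edge therefore forces
the order to be preserved.

A permutation of length at least two is an inflation of a simple one by proper blocks
(`FinPerm.exists_isIntervalChoice`). In a minimal bad sequence these blocks are wqo
(`isPWO_restrict_of_isMinBadSeq`), so blocks and marks can serve as labels of the quotient graphs.
The hypothesis on graphs, applied to these labels rather than to `L`, gives an embedding that glues
with the block embeddings (`LabeledPerm.le_of_graph_embedding`) and contradicts badness. -/

/-! ### Colourings without rainbow triangles -/

/-- One step inside `S` along an edge of colour `k`. -/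
def ColorStep {V K : Type*} (c : V → V → K) (S : Finset V) (k : K) (x y : V) : Prop :=
  x ∈ S ∧ y ∈ S ∧ x ≠ y ∧ c x y = k

/-- Connectedness inside `S` along edges of colour `k`. -/
def ColorConn {V K : Type*} (c : V → V → K) (S : Finset V) (k : K) : V → V → Prop :=
  Relation.ReflTransGen (ColorStep c S k)

theorem ColorStep.symm {V K : Type*} {c : V → V → K} (hc : ∀ x y, c x y = c y x) {S : Finset V}
    {k : K} {x y : V} (h : ColorStep c S k x y) : ColorStep c S k y x :=
  ⟨h.2.1, h.1, h.2.2.1.symm, (hc y x).trans h.2.2.2⟩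

theorem ColorConn.symm {V K : Type*} {c : V → V → K} (hc : ∀ x y, c x y = c y x) {S : Finset V}
    {k : K} {x y : V} (h : ColorConn c S k x y) : ColorConn c S k y x := by
  induction h with
  | refl => exact .refl
  | tail _ hd ih => exact .head (hd.symm hc) ih

/-- No triangle receives three distinct colours. -/
def IsRainbowFree {V K : Type*} (c : V → V → K) : Prop :=
  ∀ x y z, x ≠ y → y ≠ z → x ≠ z → c x y = c y z ∨ c y z = c x z ∨ c x y = c x z

/-- In a colouring without rainbow triangles, a vertex outside a component of colour `k` sends
edges of a single colour to that component. -/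
theorem ColorConn.color_eq {V K : Type*} {c : V → V → K} (hc : ∀ x y, c x y = c y x)
    (hr : IsRainbowFree c) {S : Finset V} {k : K} {w y y' : V} (hw : w ∈ S)
    (hwy : ¬ ColorConn c S k w y) (h : ColorConn c S k y y') : c w y = c w y' := by
  induction h with
  | refl => rfl
  | @tail b d hb hd ih =>
    have hb' : ¬ ColorConn c S k w b := fun h => hwy (h.trans (ColorConn.symm hc hb))
    have hd' : ¬ ColorConn c S k w d := fun h => hb' (h.trans (.single (hd.symm hc)))
    have h1 : w ≠ b := fun h => hb' (h ▸ .refl)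
    have h2 : w ≠ d := fun h => hd' (h ▸ .refl)
    have h3 : c w b ≠ k := fun h => hb' (.single ⟨hw, hd.1, h1, h⟩)
    have h4 : c w d ≠ k := fun h => hd' (.single ⟨hw, hd.2.1, h2, h⟩)
    rcases hr w b d h1 hd.2.2.1 h2 with h | h | h
    · exact absurd (h.trans hd.2.2.2) h3
    · exact absurd (h.symm.trans hd.2.2.2) h4
    · exact ih.trans h

/-- If a colouring without rainbow triangles is extended by a vertex `v` to a set on which every
colour is connected, then every colour was already connected. -/
theorem ColorConn.of_insert {V K : Type*} [DecidableEq V] {c : V → V → K}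
    (hc : ∀ x y, c x y = c y x) (hr : IsRainbowFree c) {T : Finset V} {v : V} (hv : v ∉ T)
    (hall : ∀ k, ∀ a ∈ insert v T, ∀ b ∈ insert v T, ColorConn c (insert v T) k a b)
    {D F B : K} (hDF : F ≠ D) (hDB : B ≠ D) (hFB : F ≠ B) {a b : V} (ha : a ∈ T) (hb : b ∈ T) :
    ColorConn c T D a b := by
  by_contra hab
  have hne : ∀ {x}, x ∈ T → v ≠ x := fun hx h => hv (h ▸ hx)
  have hnbr : ∀ k, ∃ w ∈ T, c v w = k := by
    intro k
    rcases (hall k v (by simp) a (by simp [ha])).cases_head with h | ⟨w, hw, -⟩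
    · exact absurd h (hne ha)
    · exact ⟨w, (Finset.mem_insert.1 hw.2.1).resolve_left hw.2.2.1.symm, hw.2.2.2⟩
  -- Adding `v` makes `D` connected, so a `D`-path from `y` to `v` must leave the component of `y`
  -- by a `D`-edge into `v`.
  have hcomp : ∀ y ∈ T, ∃ u ∈ T, ColorConn c T D y u ∧ c v u = D := by
    intro y hy
    have key : y = v ∨ ∃ u ∈ T, ColorConn c T D y u ∧ c v u = D := by
      have hyv := hall D y (by simp [hy]) v (by simp)
      clear hy
      induction hyv using Relation.ReflTransGen.head_induction_on with
      | refl => exact .inl rfl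
      | @head x z hxz _ ih =>
        by_cases hx : x = v
        · exact .inl hx
        have hxT := (Finset.mem_insert.1 hxz.1).resolve_left hx
        right
        rcases ih with rfl | ⟨u, hu, hzu, hvu⟩
        · exact ⟨x, hxT, .refl, (hc _ _).trans hxz.2.2.2⟩
        · by_cases hz : z = v
          · exact ⟨x, hxT, .refl, (hc _ _).trans (hz ▸ hxz.2.2.2)⟩
          · exact ⟨u, hu, .head ⟨hxT, (Finset.mem_insert.1 hxz.2.1).resolve_left hz, hxz.2.2⟩ hzu,
              hvu⟩
    exact key.resolve_left (hne hy).symm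
  -- In the triangle `v w u`, with `u` a `D`-neighbour of `v` in the component of `y`, the edge `w
  -- u` is not `D`, so it must copy `v w`.
  have hout : ∀ k, k ≠ D → ∀ w ∈ T, c v w = k → ∀ y ∈ T, ¬ ColorConn c T D w y → c w y = k := by
    intro k hk w hw hvw y hy hwy
    obtain ⟨u, hu, hyu, hvu⟩ := hcomp y hy
    have hwu : ¬ ColorConn c T D w u := fun h => hwy (h.trans (hyu.symm hc))
    have hne' : w ≠ u := fun h => hwu (h ▸ .refl)
    rw [ColorConn.color_eq hc hr hw hwy hyu]
    rcases hr v w u (hne hw) hne' (hne hu) with h | h | h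
    · exact h.symm.trans hvw
    · exact absurd (.single ⟨hw, hu, hne', h.trans hvu⟩) hwu
    · exact absurd (hvw.symm.trans (h.trans hvu)) hk
  obtain ⟨w, hw, hvw⟩ := hnbr F
  obtain ⟨w', hw', hvw'⟩ := hnbr B
  -- Either a vertex outside the common component sees both `F` and `B` there, or the edge `w w'`
  -- has both colours.
  by_cases hww : ColorConn c T D w w'
  · obtain ⟨y, hy, hwy⟩ : ∃ y ∈ T, ¬ ColorConn c T D w y := by
      by_contra! h
      exact hab (((h a ha).symm hc).trans (h b hb))
    have h1 := hout F hDF w hw hvw y hy hwy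
    have h2 := hout B hDB w' hw' hvw' y hy fun h => hwy (hww.trans h)
    have h3 := ColorConn.color_eq hc hr hy (fun h => hwy (h.symm hc)) hww
    exact hFB (h1.symm.trans ((hc _ _).trans (h3.trans ((hc _ _).trans h2))))
  · have h1 := hout F hDF w hw hvw w' hw' hww
    have h2 := hout B hDB w' hw' hvw' w hw fun h => hww (h.symm hc)
    exact hFB (h1.symm.trans ((hc _ _).trans h2))

/-- A 3-colouring without rainbow triangles has a disconnected colour. -/
theorem IsRainbowFree.exists_not_colorConn {V : Type*} {c : V → V → Fin 3}
    (hc : ∀ x y, c x y = c y x) (hr : IsRainbowFree c) (S : Finset V) (hS : S.Nontrivial) :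
    ∃ k, ∃ a ∈ S, ∃ b ∈ S, ¬ ColorConn c S k a b := by
  classical
  induction S using Finset.induction_on with
  | empty => exact absurd hS (by simp)
  | @insert v T hv ih =>
    by_contra! hall
    by_cases hT : T.Nontrivial
    · obtain ⟨D, a, ha, b, hb, hab⟩ := ih hT
      refine hab (ColorConn.of_insert hc hr hv hall (F := D + 1) (B := D + 2) ?_ ?_ ?_ ha hb) <;>
        clear hab <;> revert D <;> decide
    · obtain ⟨w, hw⟩ : ∃ w, w ∈ T := by
        by_contra! h
        rw [Finset.eq_empty_of_forall_notMem h] at hS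
        exact absurd hS (by simp)
      have hvw : v ≠ w := fun h => hv (h ▸ hw)
      -- Two vertices span a single edge, so any colour other than its own is disconnected.
      rcases (hall (c v w + 1) v (by simp) w (by simp [hw])).cases_head with h | ⟨u, hu, -⟩
      · exact hvw h
      · have huT := (Finset.mem_insert.1 hu.2.1).resolve_left hu.2.2.1.symm
        have : u = w := by
          by_contra huw
          exact hT ⟨u, huT, w, hw, huw⟩
        have h := hu.2.2.2
        rw [this] at h
        revert h
        generalize c v w = k
        revert k
        decide

/-- If a linear order remains transitive under reversal of any set of colours of a 3-colouring and
all colours occur, then there is a nontrivial homogeneous interval. -/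
theorem exists_homogeneous_interval {V : Type*} [Finite V] [LinearOrder V] {c : V → V → Fin 3}
    (hc : ∀ x y, c x y = c y x)
    (H : ∀ x y z, x < y → y < z → c x z = c x y ∨ c x z = c y z)
    (hused : ∀ k, ∃ x y, x ≠ y ∧ c x y = k) :
    ∃ M : Set V, M.Nontrivial ∧ M ≠ Set.univ ∧
      ∀ z ∉ M, ∀ m ∈ M, ∀ m' ∈ M, (z < m ↔ z < m') ∧ c z m = c z m' := by
  classical
  have := Fintype.ofFinite V
  have hr : IsRainbowFree c := by
    intro x y z hxy hyz hxz
    have e1 := hc x y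
    have e2 := hc y z
    have e3 := hc x z
    rcases lt_or_gt_of_ne hxy with h1 | h1 <;> rcases lt_or_gt_of_ne hyz with h2 | h2 <;>
      rcases lt_or_gt_of_ne hxz with h3 | h3 <;> grind
  obtain ⟨x₀, y₀, hxy₀, -⟩ := hused 0
  obtain ⟨k, a, -, b, -, hab⟩ := hr.exists_not_colorConn hc Finset.univ
    ⟨x₀, by simp, y₀, by simp, hxy₀⟩
  obtain ⟨x, y, hxy, hk⟩ := hused k
  have hstep : ColorConn c Finset.univ k x y := .single ⟨by simp, by simp, hxy, hk⟩
  have hmain : ∀ z m, ¬ ColorConn c Finset.univ k z m → ∀ m', ColorConn c Finset.univ k m m' →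
      (z < m ↔ z < m') := by
    intro z m hzm m' h
    induction h with
    | refl => rfl
    | @tail p q hp hq ih =>
      rw [ih]
      have hzp : ¬ ColorConn c Finset.univ k z p := fun h => hzm (h.trans (ColorConn.symm hc hp))
      have hzq : ¬ ColorConn c Finset.univ k z q := fun h => hzp (h.trans (.single (hq.symm hc)))
      have h1 : z ≠ p := fun h => hzp (h ▸ .refl)
      have h2 : z ≠ q := fun h => hzq (h ▸ .refl)
      have h3 : c z p ≠ k := fun h => hzp (.single ⟨by simp, by simp, h1, h⟩)
      have h4 : c z q ≠ k := fun h => hzq (.single ⟨by simp, by simp, h2, h⟩)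
      have h5 := hq.2.2.2
      have e1 := hc z p
      have e2 := hc z q
      have e3 := hc p q
      -- If `z` lay between `p` and `q`, then `H` would give `z p` or `z q` the colour `k` of `p q`,
      -- putting `z` in the component.
      constructor <;> intro h <;> by_contra h'
      · have := H q z p (lt_of_le_of_ne (not_lt.1 h') h2.symm) h
        grind
      · have := H p z q (lt_of_le_of_ne (not_lt.1 h') h1.symm) h
        grind
  refine ⟨{m | ColorConn c Finset.univ k x m}, ⟨x, .refl, y, hstep, hxy⟩, fun h => ?_, ?_⟩
  · have h1 : a ∈ {m | ColorConn c Finset.univ k x m} := h ▸ Set.mem_univ a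
    have h2 : b ∈ {m | ColorConn c Finset.univ k x m} := h ▸ Set.mem_univ b
    exact hab ((ColorConn.symm hc h1).trans h2)
  · intro z hz m hm m' hm'
    have hzm : ¬ ColorConn c Finset.univ k z m := fun h => hz (hm.trans (h.symm hc))
    have hmm : ColorConn c Finset.univ k m m' := (ColorConn.symm hc hm).trans hm'
    exact ⟨hmain z m hzm m' hmm, ColorConn.color_eq hc hr (by simp) hzm hmm⟩

/-! ### Embeddings of inversion graphs of simple permutations -/

/-- The relation `E` is the inversion graph of a permutation whose positions are ordered as `α`:
both `E` and its complement are transitive along the order of `α`. -/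
structure IsInversionRel {α : Type*} [LinearOrder α] (E : α → α → Prop) : Prop where
  symm : ∀ x y, E x y ↔ E y x
  trans : ∀ x y z, x < y → y < z → E x y → E y z → E x z
  trans_not : ∀ x y z, x < y → y < z → ¬ E x y → ¬ E y z → ¬ E x z

/-- Complementing the graph amounts to reversing the values; results on edges thus transfer to
non-edges. -/
theorem IsInversionRel.compl {α : Type*} [LinearOrder α] {E : α → α → Prop}
    (h : IsInversionRel E) : IsInversionRel fun x y => ¬ E x y :=
  ⟨fun x y => not_congr (h.symm x y), h.trans_not,
    fun x y z hxy hyz h1 h2 h3 => h3 (h.trans x y z hxy hyz (not_not.1 h1) (not_not.1 h2))⟩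

/-- There is no nontrivial proper interval. -/
def IsSimpleRel {α : Type*} [LinearOrder α] (E : α → α → Prop) : Prop :=
  ∀ M : Set α, M.Nontrivial →
    (∀ z ∉ M, ∀ m ∈ M, ∀ m' ∈ M, (z < m ↔ z < m') ∧ (E z m ↔ E z m')) → M = Set.univ

theorem IsSimpleRel.compl {α : Type*} [LinearOrder α] {E : α → α → Prop}
    (h : IsSimpleRel E) : IsSimpleRel fun x y => ¬ E x y :=
  fun M hM hM' => h M hM fun z hz m hm m' hm' =>
    ⟨(hM' z hz m hm m' hm').1, not_iff_not.1 (hM' z hz m hm m' hm').2⟩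

/-- An embedding of the inversion graph of a simple permutation either preserves or reverses the
orientations of all edges. -/
theorem IsSimpleRel.lt_of_lt {V W : Type*} [Finite V] [LinearOrder V] [LinearOrder W]
    {E : V → V → Prop} {E' : W → W → Prop} (hE : IsInversionRel E) (hE' : IsInversionRel E')
    (hs : IsSimpleRel E) {f : V → W} (hf : Function.Injective f)
    (hfE : ∀ x y, x ≠ y → (E' (f x) (f y) ↔ E x y)) {a b x y : V} (hab : a < b) (eab : E a b)
    (fab : f a < f b) (hxy : x < y) (exy : E x y) : f x < f y := by
  classical
  by_contra hnot
  have hfxy : f y < f x := lt_of_le_of_ne (not_lt.1 hnot) fun h => hxy.ne' (hf h)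
  by_cases hnon : ∃ p q, p ≠ q ∧ ¬ E p q
  · obtain ⟨p, q, hpq, epq⟩ := hnon
    let c : V → V → Fin 3 := fun u v =>
      if E u v then (if (u < v ↔ f u < f v) then 1 else 2) else 0
    have hcE : ∀ u v, c u v = 0 ↔ ¬ E u v := by
      intro u v
      simp only [c]
      split_ifs <;> simp_all
    have hc1 : ∀ u v, c u v = 1 ↔ E u v ∧ (u < v ↔ f u < f v) := by
      intro u v
      simp only [c]
      split_ifs <;> simp_all
    have hc2 : ∀ u v, c u v = 2 ↔ E u v ∧ ¬ (u < v ↔ f u < f v) := by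
      intro u v
      simp only [c]
      split_ifs <;> simp_all
    have hcs : ∀ u v, c u v = c v u := by
      intro u v
      rcases eq_or_ne u v with rfl | huv
      · rfl
      have h1 : (u < v ↔ f u < f v) ↔ (v < u ↔ f v < f u) := by
        have := hf.ne huv
        rcases lt_or_gt_of_ne huv with h | h <;> rcases lt_or_gt_of_ne this with h' | h' <;>
          simp [h, h', h.not_gt, h'.not_gt]
      simp only [c, hE.symm u v, h1]
    -- Transitivity of both relations, of their complements and of the order on `W` settles each
    -- triple.
    obtain ⟨M, hM, hM', hMM⟩ := exists_homogeneous_interval hcs (by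
      intro u v w huv hvw
      have huw := huv.trans hvw
      have n1 := hf.ne huv.ne
      have n2 := hf.ne hvw.ne
      have n3 := hf.ne huw.ne
      have g1 := hfE u v huv.ne
      have g2 := hfE v w hvw.ne
      have g3 := hfE u w huw.ne
      have t1 := hE.trans u v w huv hvw
      have t2 := hE.trans_not u v w huv hvw
      have s1 := hE'.symm (f u) (f v)
      have s2 := hE'.symm (f v) (f w)
      have s3 := hE'.symm (f u) (f w)
      have key : ∀ p q r, p < q → q < r → (E' p q → E' q r → E' p r) ∧
        (¬ E' p q → ¬ E' q r → ¬ E' p r) :=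
        fun p q r h h' => ⟨hE'.trans p q r h h', hE'.trans_not p q r h h'⟩
      simp only [c, huv, hvw, huw, true_iff]
      rcases lt_or_gt_of_ne n1 with h1 | h1 <;> rcases lt_or_gt_of_ne n2 with h2 | h2 <;>
        rcases lt_or_gt_of_ne n3 with h3 | h3 <;> grind) (by
      intro k
      fin_cases k
      · exact ⟨p, q, hpq, (hcE p q).2 epq⟩
      · exact ⟨a, b, hab.ne, (hc1 a b).2 ⟨eab, by simp [hab, fab]⟩⟩
      · exact ⟨x, y, hxy.ne, (hc2 x y).2 ⟨exy, by simp [hxy, hfxy.not_gt]⟩⟩)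
    refine hM' (hs M hM fun z hz m hm m' hm' => ⟨(hMM z hz m hm m' hm').1, ?_⟩)
    rw [← not_iff_not, ← hcE, ← hcE, (hMM z hz m hm m' hm').2]
  -- Without non-edges colour `0` is missing. Then all vertices but the minimum form an interval,
  -- and simplicity leaves at most two vertices, hence a single pair.
  · push Not at hnon
    have : Nonempty V := ⟨a⟩
    obtain ⟨v, hv⟩ := Finite.exists_min (id : V → V)
    have hM : ({v}ᶜ : Set V).Nontrivial := by
      by_contra h
      rw [Set.not_nontrivial_iff] at h
      have hbv : b ≠ v := (lt_of_le_of_lt (hv a) hab).ne'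
      have hyv : y ≠ v := (lt_of_le_of_lt (hv x) hxy).ne'
      have hby : b = y := h hbv hyv
      have hax : a ≠ x := by
        rintro rfl
        subst hby
        exact fab.asymm hfxy
      by_cases hav : a = v
      · exact hxy.ne (h (fun hxv => hax (hav.trans hxv.symm)) hyv)
      · exact hab.ne (h hav hbv)
    have := hs _ hM (by
      intro z hz m hm m' hm'
      have hzv : z = v := by simpa using hz
      subst hzv
      have h1 : z < m := lt_of_le_of_ne (hv m) fun h => hm h.symm
      have h2 : z < m' := lt_of_le_of_ne (hv m') fun h => hm' h.symm
      exact ⟨iff_of_true h1 h2, iff_of_true (hnon _ _ h1.ne) (hnon _ _ h2.ne)⟩)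
    have hvm : v ∈ ({v}ᶜ : Set V) := this ▸ Set.mem_univ v
    exact hvm rfl

/-- An embedding of the inversion graph of a simple permutation that preserves the orientations of
some edge and of some non-edge preserves the order of positions. -/
theorem IsSimpleRel.strictMono {V W : Type*} [Finite V] [LinearOrder V] [LinearOrder W]
    {E : V → V → Prop} {E' : W → W → Prop} (hE : IsInversionRel E) (hE' : IsInversionRel E')
    (hs : IsSimpleRel E) {f : V → W} (hf : Function.Injective f)
    (hfE : ∀ x y, x ≠ y → (E' (f x) (f y) ↔ E x y))
    (h₁ : (∃ x y, x < y ∧ E x y) → ∃ x y, (x < y ∧ E x y) ∧ f x < f y)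
    (h₂ : (∃ x y, x < y ∧ ¬ E x y) → ∃ x y, (x < y ∧ ¬ E x y) ∧ f x < f y) : StrictMono f := by
  intro x y hxy
  by_cases exy : E x y
  · obtain ⟨a, b, ⟨hab, eab⟩, fab⟩ := h₁ ⟨x, y, hxy, exy⟩
    exact hs.lt_of_lt hE hE' hf hfE hab eab fab hxy exy
  · obtain ⟨a, b, ⟨hab, eab⟩, fab⟩ := h₂ ⟨x, y, hxy, exy⟩
    exact hs.compl.lt_of_lt hE.compl hE'.compl hf (fun x y h => not_congr (hfE x y h))
      hab eab fab hxy exy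

/-- A mark of the pairs that satisfy `R`. -/
theorem exists_marks {α : Type*} (R : α → α → Prop) : ∃ m : Bool → Set α,
    (∀ a b, a ∈ m false → b ∈ m true → R a b) ∧
      ((∃ a b, R a b) → ∃ a ∈ m false, ∃ b ∈ m true, R a b) := by
  by_cases h : ∃ a b, R a b
  · obtain ⟨a, b, hab⟩ := h
    exact ⟨fun i => if i then {b} else {a}, by simpa using hab, fun _ => by simpa using hab⟩
  -- With no related pair, empty marks satisfy the first clause vacuously.
  · exact ⟨fun _ => ∅, by simp, fun h' => absurd h' h⟩

/-! ### Patterns on sets of positions -/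

/-- The pattern of `π` on a set of positions. -/
def FinPerm.restrict (π : FinPerm) (S : Finset (Fin π.length)) : FinPerm where
  length := S.card
  toEquiv := (S.orderIsoOfFin rfl).toEquiv.trans <|
    (π.toEquiv.subtypeEquiv (q := (· ∈ S.map π.toEquiv.toEmbedding)) (by simp)).trans
      ((S.map π.toEquiv.toEmbedding).orderIsoOfFin (S.card_map _)).toEquiv.symm

theorem FinPerm.restrict_lt_iff (π : FinPerm) (S : Finset (Fin π.length)) (i j : Fin S.card) :
    (π.restrict S).toEquiv i < (π.restrict S).toEquiv j ↔
      π.toEquiv (S.orderIsoOfFin rfl i) < π.toEquiv (S.orderIsoOfFin rfl j) :=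
  ((S.map π.toEquiv.toEmbedding).orderIsoOfFin (S.card_map _)).symm.lt_iff_lt

theorem FinPerm.isOccurrence_restrict (π : FinPerm) (S : Finset (Fin π.length)) :
    (π.restrict S).IsOccurrence π fun i => S.orderIsoOfFin rfl i :=
  ⟨fun _ _ h => (S.orderIsoOfFin rfl).lt_iff_lt.2 h, fun i j => (π.restrict_lt_iff S i j).symm⟩

theorem FinPerm.restrict_le (π : FinPerm) (S : Finset (Fin π.length)) : π.restrict S ≤ π :=
  ⟨_, π.isOccurrence_restrict S⟩

/-- The labeled pattern of `p` on a set of positions. -/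
def LabeledPerm.restrict {L : Type u} (p : LabeledPerm L) (S : Finset (Fin p.perm.length)) :
    LabeledPerm L where
  perm := p.perm.restrict S
  label i := p.label (S.orderIsoOfFin rfl i)

theorem LabeledPerm.restrict_le {L : Type u} [Preorder L] (p : LabeledPerm L)
    (S : Finset (Fin p.perm.length)) : p.restrict S ≤ p :=
  ⟨_, p.perm.isOccurrence_restrict S, fun _ => le_rfl⟩

theorem LabeledPerm.exists_map_of_restrict_le {L : Type u} [Preorder L] {p q : LabeledPerm L}
    {A : Finset (Fin p.perm.length)} {B : Finset (Fin q.perm.length)}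
    (h : p.restrict A ≤ q.restrict B) :
    ∃ g : A → B, StrictMono g ∧ (∀ a : A, p.label a ≤ q.label (g a)) ∧
      ∀ a b : A, q.perm.toEquiv (g a) < q.perm.toEquiv (g b) ↔
        p.perm.toEquiv a < p.perm.toEquiv b := by
  obtain ⟨f, ⟨hmono, hval⟩, hlab⟩ := h
  have hval' : ∀ i j : Fin A.card, q.perm.toEquiv (B.orderIsoOfFin rfl (f i)) <
      q.perm.toEquiv (B.orderIsoOfFin rfl (f j)) ↔
      p.perm.toEquiv (A.orderIsoOfFin rfl i) < p.perm.toEquiv (A.orderIsoOfFin rfl j) := by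
    intro i j
    exact (q.perm.restrict_lt_iff B _ _).symm.trans
      ((hval i j).trans (p.perm.restrict_lt_iff A i j))
  refine ⟨fun a : A => B.orderIsoOfFin rfl (f ((A.orderIsoOfFin rfl).symm a)), fun a b hab => ?_,
    fun a => ?_, fun a b => ?_⟩
  · exact (B.orderIsoOfFin rfl).lt_iff_lt.2 (hmono ((A.orderIsoOfFin rfl).symm.lt_iff_lt.2 hab))
  · have := hlab ((A.orderIsoOfFin rfl).symm a)
    simpa only [LabeledPerm.restrict, OrderIso.apply_symm_apply] using this
  · rw [hval']
    simp only [OrderIso.apply_symm_apply]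

/-- Position order and graph together determine the values, so a graph embedding that is monotone on
positions is an occurrence. -/
theorem FinPerm.lt_iff_adj (π : FinPerm) {i j : Fin π.length} (h : i ≠ j) :
    π.toEquiv i < π.toEquiv j ↔ (i < j ↔ ¬ π.inversionGraph.Adj i j) := by
  have := π.toEquiv.injective.ne h
  simp only [FinPerm.inversionGraph]
  rcases lt_or_gt_of_ne h with h | h <;> rcases lt_or_gt_of_ne this with h' | h' <;>
    simp [h, h', h.not_gt, h'.not_gt]

theorem FinPerm.isInversionRel (π : FinPerm) : IsInversionRel π.inversionGraph.Adj := by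
  refine ⟨fun x y => π.inversionGraph.adj_comm x y, fun x y z hxy hyz => ?_,
    fun x y z hxy hyz => ?_⟩ <;>
  · have hxz := hxy.trans hyz
    have h1 := π.toEquiv.injective.ne hxy.ne
    have h2 := π.toEquiv.injective.ne hyz.ne
    simp only [FinPerm.inversionGraph, hxy, hyz, hxz, hxy.not_gt, hyz.not_gt, hxz.not_gt]
    grind

theorem IsInversionRel.subtype {α : Type*} [LinearOrder α] {E : α → α → Prop}
    (h : IsInversionRel E) (P : α → Prop) : IsInversionRel fun x y : {x // P x} => E x y :=
  ⟨fun x y => h.symm x y, fun x y z => h.trans x y z, fun x y z => h.trans_not x y z⟩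

/-! ### Inflations of simple permutations -/

/-- The map `r` chooses a representative in each block of a partition of `π` into intervals. -/
structure FinPerm.IsIntervalChoice (π : FinPerm) (r : Fin π.length → Fin π.length) : Prop where
  idem : ∀ i, r (r i) = r i
  lt_iff : ∀ i j, r i ≠ r j → (i < j ↔ r i < r j)
  val_lt_iff : ∀ i j, r i ≠ r j →
    (π.toEquiv i < π.toEquiv j ↔ π.toEquiv (r i) < π.toEquiv (r j))

/-- Every permutation of length at least two is an inflation of a simple permutation, each block
being proper. -/
theorem FinPerm.exists_isIntervalChoice (π : FinPerm) : ∃ r, π.IsIntervalChoice r ∧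
    (π.length ≤ 1 ∨ ∀ s, ∃ i, r i ≠ s) ∧
      IsSimpleRel fun x y : {x // r x = x} => π.inversionGraph.Adj x y := by
  classical
  let P : (Fin π.length → Fin π.length) → Prop := fun r =>
    π.IsIntervalChoice r ∧ (π.length ≤ 1 ∨ ∀ s, ∃ i, r i ≠ s)
  have hid : P id := by
    refine ⟨⟨fun _ => rfl, fun _ _ _ => Iff.rfl, fun _ _ _ => Iff.rfl⟩, ?_⟩
    by_cases h : π.length ≤ 1
    · exact .inl h
    · have : Nontrivial (Fin π.length) := Fin.nontrivial_iff_two_le.2 (by omega)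
      exact .inr fun s => exists_ne s
  obtain ⟨r, ⟨hr, hr'⟩, hmin⟩ := exists_minimalFor_of_wellFoundedLT P
    (fun r => (Finset.univ.filter fun i => r i = i).card) ⟨id, hid⟩
  refine ⟨r, hr, hr', fun M hM hMM => ?_⟩
  by_contra hne
  obtain ⟨m₀, hm₀, m₁, hm₁, hm⟩ := hM
  obtain ⟨z₀, hz₀⟩ := (Set.ne_univ_iff_exists_notMem M).1 hne
  let q : Fin π.length → {x // r x = x} := fun i => ⟨r i, hr.idem i⟩
  have hq : ∀ x : {x // r x = x}, q x = x := fun x => Subtype.ext x.2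
  -- Merging the blocks indexed by `M` into one, represented by `m₀`, contradicts minimality: `m₁`
  -- stops being a representative, while `z₀` keeps at least two blocks.
  let r' : Fin π.length → Fin π.length := fun i => if q i ∈ M then m₀ else r i
  have hpos : ∀ i, q i ∈ M → r' i = m₀ := fun i hi => if_pos hi
  have hneg : ∀ i, q i ∉ M → r' i = r i := fun i hi => if_neg hi
  have hfix : ∀ i, q (r i) = q i := fun i => Subtype.ext (hr.idem i)
  have hlt : ∀ z ∉ M, ∀ m ∈ M, (z < m ↔ z < m₀) ∧ (m < z ↔ m₀ < z) ∧
      (π.toEquiv z < π.toEquiv m ↔ π.toEquiv z < π.toEquiv m₀) ∧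
      (π.toEquiv m < π.toEquiv z ↔ π.toEquiv m₀ < π.toEquiv z) := by
    intro z hz m hm
    obtain ⟨h1, h2⟩ := hMM z hz m hm m₀ hm₀
    dsimp only at h2
    have n1 : z ≠ m := fun h => hz (h ▸ hm)
    have n2 : z ≠ m₀ := fun h => hz (h ▸ hm₀)
    have n1' : (z : Fin π.length) ≠ m := fun h => n1 (Subtype.ext h)
    have n2' : (z : Fin π.length) ≠ m₀ := fun h => n2 (Subtype.ext h)
    have h3 : m < z ↔ m₀ < z := by
      rw [← not_iff_not, not_lt, not_lt, n1.le_iff_lt, n2.le_iff_lt, h1]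
    refine ⟨h1, h3, ?_, ?_⟩
    · rw [π.lt_iff_adj n1', π.lt_iff_adj n2', h2]
      exact iff_congr h1 Iff.rfl
    · rw [π.lt_iff_adj n1'.symm, π.lt_iff_adj n2'.symm, SimpleGraph.adj_comm _ (m : Fin π.length),
        SimpleGraph.adj_comm _ (m₀ : Fin π.length), h2]
      exact iff_congr h3 Iff.rfl
  have hP : P r' := by
    refine ⟨⟨fun i => ?_, fun i j hij => ?_, fun i j hij => ?_⟩, ?_⟩
    · by_cases hi : q i ∈ M
      · rw [hpos i hi, hpos _ (by rwa [hq])]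
      · rw [hneg i hi, hneg _ (by rwa [hfix]), hr.idem]
    · by_cases hi : q i ∈ M <;> by_cases hj : q j ∈ M
      · exact absurd ((hpos i hi).trans (hpos j hj).symm) hij
      · have hij' : r i ≠ r j := fun h => hj ((Subtype.ext h : q i = q j) ▸ hi)
        rw [hr.lt_iff i j hij', hpos i hi, hneg j hj]
        exact (hlt _ hj _ hi).2.1
      · have hij' : r i ≠ r j := fun h => hi ((Subtype.ext h : q i = q j) ▸ hj)
        rw [hr.lt_iff i j hij', hpos j hj, hneg i hi]
        exact (hlt _ hi _ hj).1
      · rw [hneg i hi, hneg j hj] at hij ⊢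
        exact hr.lt_iff i j hij
    · by_cases hi : q i ∈ M <;> by_cases hj : q j ∈ M
      · exact absurd ((hpos i hi).trans (hpos j hj).symm) hij
      · have hij' : r i ≠ r j := fun h => hj ((Subtype.ext h : q i = q j) ▸ hi)
        rw [hr.val_lt_iff i j hij', hpos i hi, hneg j hj]
        exact (hlt _ hj _ hi).2.2.2
      · have hij' : r i ≠ r j := fun h => hi ((Subtype.ext h : q i = q j) ▸ hj)
        rw [hr.val_lt_iff i j hij', hpos j hj, hneg i hi]
        exact (hlt _ hi _ hj).2.2.1
      · rw [hneg i hi, hneg j hj] at hij ⊢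
        exact hr.val_lt_iff i j hij
    · refine .inr fun s => ?_
      have hne' : (m₀ : Fin π.length) ≠ z₀ := fun h => hz₀ ((Subtype.ext h : m₀ = z₀) ▸ hm₀)
      have h1 : r' m₀ = m₀ := hpos _ (by rwa [hq])
      have h2 : r' z₀ = z₀ := (hneg _ (by rwa [hq])).trans z₀.2
      by_cases hs : (m₀ : Fin π.length) = s
      · exact ⟨z₀, fun h => hne' (hs.trans (h.symm.trans h2))⟩
      · exact ⟨m₀, fun h => hs (h1.symm.trans h)⟩
  have hsub : (Finset.univ.filter fun i => r' i = i) ⊂ Finset.univ.filter fun i => r i = i := by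
    rw [Finset.ssubset_iff_of_subset]
    · refine ⟨m₁, by simpa using m₁.2, ?_⟩
      simp only [Finset.mem_filter, Finset.mem_univ, true_and]
      rw [hpos _ (by rwa [hq])]
      exact fun h => hm (Subtype.ext h)
    · intro i hi
      simp only [Finset.mem_filter, Finset.mem_univ, true_and] at hi ⊢
      by_cases hi' : q i ∈ M
      · rw [hpos i hi'] at hi
        exact hi ▸ m₀.2
      · rwa [hneg i hi'] at hi
  exact (Finset.card_lt_card hsub).not_ge (hmin hP (Finset.card_le_card hsub.subset))

/-- An embedding of the quotients and embeddings of the blocks combine to an embedding. -/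
theorem LabeledPerm.le_of_blocks_le {L : Type u} [Preorder L] {p q : LabeledPerm L}
    {r : Fin p.perm.length → Fin p.perm.length} {t : Fin q.perm.length → Fin q.perm.length}
    (hr : p.perm.IsIntervalChoice r) (ht : q.perm.IsIntervalChoice t)
    (f : {x // r x = x} → {x // t x = x}) (hf : StrictMono f)
    (hfv : ∀ x y : {x // r x = x}, q.perm.toEquiv (f x) < q.perm.toEquiv (f y) ↔
      p.perm.toEquiv x < p.perm.toEquiv y)
    (hb : ∀ x : {x // r x = x}, p.restrict (Finset.univ.filter fun i => r i = x) ≤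
      q.restrict (Finset.univ.filter fun i => t i = f x)) : p ≤ q := by
  choose g hg hgl hgv using fun x : {x // r x = x} => LabeledPerm.exists_map_of_restrict_le (hb x)
  let s : Fin p.perm.length → {x // r x = x} := fun i => ⟨r i, hr.idem i⟩
  have hmem : ∀ i (x : {x // r x = x}), s i = x → i ∈ Finset.univ.filter fun i => r i = x := by
    rintro i _ rfl
    simp [s]
  let F : Fin p.perm.length → Fin q.perm.length := fun i => g (s i) ⟨i, hmem i _ rfl⟩
  have hF : ∀ i x (h : s i = x), F i = g x ⟨i, hmem i x h⟩ := by
    rintro i _ rfl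
    rfl
  have htF : ∀ i, t (F i) = f (s i) := by
    intro i
    exact (Finset.mem_filter.1 (g (s i) ⟨i, hmem i _ rfl⟩).2).2
  have hne : ∀ i j, s i ≠ s j → t (F i) ≠ t (F j) := by
    intro i j hij h
    rw [htF, htF] at h
    exact hij (hf.injective (Subtype.ext h))
  refine ⟨F, ⟨fun i j hij => ?_, fun i j => ?_⟩, fun i => hgl (s i) ⟨i, hmem i _ rfl⟩⟩
  · by_cases h : s i = s j
    · rw [hF i _ h, hF j _ rfl]
      exact hg (s j) hij
    -- Entries of different blocks compare as their representatives do.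
    · have hr' : r i ≠ r j := fun h' => h (Subtype.ext h')
      rw [ht.lt_iff _ _ (hne i j h), htF, htF]
      exact hf ((hr.lt_iff i j hr').1 hij)
  · by_cases h : s i = s j
    · rw [hF i _ h, hF j _ rfl]
      exact hgv (s j) _ _
    · have hr' : r i ≠ r j := fun h' => h (Subtype.ext h')
      rw [ht.val_lt_iff _ _ (hne i j h), htF, htF, hfv, hr.val_lt_iff i j hr']

theorem FinPerm.IsOccurrence.adj_iff {σ π : FinPerm} {f : Fin σ.length → Fin π.length}
    (h : σ.IsOccurrence π f) (i j : Fin σ.length) :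
    π.inversionGraph.Adj (f i) (f j) ↔ σ.inversionGraph.Adj i j := by
  simp only [FinPerm.inversionGraph, h.1.lt_iff_lt, h.2]

/-- An induced subgraph of an inversion graph is the inversion graph of a pattern, and `C` is closed
downward; this admits the quotient graphs. -/
theorem comap_inversionGraph_mem {C : Set FinPerm} (hC : IsLowerSet C) {π : FinPerm} (hπ : π ∈ C)
    (P : Fin π.length → Prop) :
    (⟨{x // P x}, inferInstance, π.inversionGraph.comap Subtype.val⟩ : FinGraph) ∈
      inversionGraphClass C := by
  classical
  let S : Finset (Fin π.length) := Finset.univ.filter P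
  let e : {x // P x} ≃ Fin S.card :=
    (Equiv.subtypeEquivRight fun x => by simp [S]).trans (S.orderIsoOfFin rfl).toEquiv.symm
  have he : ∀ x, ((S.orderIsoOfFin rfl (e x) : S) : Fin π.length) = x := fun x => by simp [e]
  refine ⟨π.restrict S, hC (π.restrict_le S) hπ, ⟨⟨e, fun {a b} => ?_⟩⟩⟩
  refine ((π.isOccurrence_restrict S).adj_iff (e a) (e b)).symm.trans ?_
  simp only [he]
  exact Iff.rfl

/-- A graph embedding between the quotients of two permutations that respects the blocks and the
marks of one edge and one non-edge gives an embedding of the permutations. -/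
theorem LabeledPerm.le_of_graph_embedding {L : Type u} [Preorder L] {p q : LabeledPerm L}
    {r : Fin p.perm.length → Fin p.perm.length} {t : Fin q.perm.length → Fin q.perm.length}
    (hr : p.perm.IsIntervalChoice r) (ht : q.perm.IsIntervalChoice t)
    (hs : IsSimpleRel fun x y : {x // r x = x} => p.perm.inversionGraph.Adj x y)
    (f : (p.perm.inversionGraph.comap (Subtype.val : {x // r x = x} → _)) ↪g
      (q.perm.inversionGraph.comap (Subtype.val : {x // t x = x} → _)))
    (hb : ∀ x : {x // r x = x}, p.restrict (Finset.univ.filter fun i => r i = x) ≤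
      q.restrict (Finset.univ.filter fun i => t i = f x))
    (h₁ : (∃ x y : {x // r x = x}, x < y ∧ p.perm.inversionGraph.Adj x y) →
      ∃ x y : {x // r x = x}, (x < y ∧ p.perm.inversionGraph.Adj x y) ∧ f x < f y)
    (h₂ : (∃ x y : {x // r x = x}, x < y ∧ ¬ p.perm.inversionGraph.Adj x y) →
      ∃ x y : {x // r x = x}, (x < y ∧ ¬ p.perm.inversionGraph.Adj x y) ∧ f x < f y) : p ≤ q := by
  have hadj : ∀ x y, q.perm.inversionGraph.Adj (f x) (f y) ↔ p.perm.inversionGraph.Adj x y :=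
    fun x y => f.map_rel_iff (a := x) (b := y)
  have hmono : StrictMono f := hs.strictMono (p.perm.isInversionRel.subtype _)
    (q.perm.isInversionRel.subtype _) f.injective (fun x y _ => hadj x y) h₁ h₂
  refine LabeledPerm.le_of_blocks_le hr ht f hmono (fun x y => ?_) hb
  rcases eq_or_ne x y with rfl | hxy
  · simp
  · rw [FinPerm.lt_iff_adj _ fun h => hxy (Subtype.ext h),
      FinPerm.lt_iff_adj _ fun h => hxy (f.injective (Subtype.ext h)), hadj]
    exact iff_congr hmono.lt_iff_lt Iff.rfl

/-! ### Minimal bad sequences and the two implications -/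

open Set.PartiallyWellOrderedOn in
/-- The proper patterns of the members of a minimal bad sequence are well-quasi-ordered. -/
theorem isPWO_restrict_of_isMinBadSeq {L : Type u} [Preorder L] {s : Set (LabeledPerm L)}
    (hs : IsLowerSet s) {f : ℕ → LabeledPerm L} (hf : IsBadSeq (· ≤ ·) s f)
    (hmin : ∀ n, IsMinBadSeq (· ≤ ·) (fun p : LabeledPerm L => p.perm.length) s n f) :
    {x | ∃ n S, S ≠ Finset.univ ∧ x = (f n).restrict S}.IsPWO := by
  by_contra hT
  rw [Set.IsPWO, iff_forall_not_isBadSeq] at hT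
  push Not at hT
  obtain ⟨g, hgT, hg⟩ := hT
  choose n S hS hgS using hgT
  have hgle : ∀ k, g k ≤ f (n k) := fun k => hgS k ▸ (f (n k)).restrict_le (S k)
  obtain ⟨k₀, -, hk₀⟩ := exists_minimalFor_of_wellFoundedLT (fun _ : ℕ => True) n ⟨0, trivial⟩
  have hk₀' : ∀ k, n k₀ ≤ n k := fun k => by
    by_contra h
    exact h (hk₀ trivial (le_of_not_ge h))
  -- Follow `f` up to index `n k₀`, then `g` from `k₀` on. As `n k₀` is least, a relation from `f i`
  -- to a later `g k` would give `f i ≤ f (n k)` with `i < n k`.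
  refine hmin (n k₀) (fun i => if i < n k₀ then f i else g (k₀ + (i - n k₀)))
    (fun m hm => (if_pos hm).symm) ?_ ⟨fun i => ?_, fun i j hij => ?_⟩
  · simp only [lt_irrefl, if_false, Nat.sub_self, Nat.add_zero, hgS k₀]
    exact (Finset.card_lt_iff_ne_univ _).2 (hS k₀) |>.trans_eq (Fintype.card_fin _)
  · dsimp only
    split_ifs
    · exact hf.1 i
    · exact hs (hgle _) (hf.1 _)
  · dsimp only
    split_ifs with hi hj hj
    · exact hf.2 i j hij
    · exact fun h => hf.2 i _ (hi.trans_le (hk₀' _)) (h.trans (hgle _))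
    · omega
    · exact hg _ _ (by omega)

/-- Covers the blocks of permutations of length at most one, which need not be proper. -/
theorem isPWO_length_le_one (L : Type u) [Preorder L] [WellQuasiOrderedLE L] :
    {p : LabeledPerm L | p.perm.length ≤ 1}.IsPWO := by
  rw [Set.IsPWO, Set.partiallyWellOrderedOn_iff_exists_lt]
  intro f hf
  have hsub : ∀ n, Subsingleton (Fin (f n).perm.length) := fun n =>
    Fin.subsingleton_iff_le_one.2 (hf n)
  by_cases h : ∃ n, (f n).perm.length = 0
  · obtain ⟨n, hn⟩ := h
    have : IsEmpty (Fin (f n).perm.length) := by rw [hn]; infer_instance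
    exact ⟨n, n + 1, n.lt_succ_self, isEmptyElim, ⟨fun i => isEmptyElim i, isEmptyElim⟩,
      isEmptyElim⟩
  · push Not at h
    let z : ∀ n, Fin (f n).perm.length := fun n => ⟨0, Nat.pos_of_ne_zero (h n)⟩
    obtain ⟨m, n, hmn, hle⟩ := (wellQuasiOrdered_le (α := L)) fun n => (f n).label (z n)
    have := hsub m
    refine ⟨m, n, hmn, fun _ => z n, ⟨fun i j hij => ?_, fun i j => ?_⟩, fun i => ?_⟩
    · exact absurd hij (Subsingleton.elim i j ▸ lt_irrefl i)
    · rw [Subsingleton.elim i j]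
      simp
    · rw [Subsingleton.elim i (z m)]
      exact hle

theorem GraphLWQO.of_permLWQO {C : Set FinPerm} (h : PermLWQO.{u} C) :
    GraphLWQO.{u} (inversionGraphClass C) := by
  intro L _ _
  rw [Set.IsPWO, Set.partiallyWellOrderedOn_iff_exists_lt]
  intro G hG
  choose π hπ e using hG
  let e' := fun n => (e n).some
  have hL := h L
  rw [Set.IsPWO, Set.partiallyWellOrderedOn_iff_exists_lt] at hL
  obtain ⟨m, n, hmn, f, hf, hlab⟩ := hL
    (fun n => ⟨π n, fun i => (G n).label ((e' n).symm i)⟩) hπ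
  refine ⟨m, n, hmn, (e' m).toRelEmbedding.trans (RelEmbedding.trans
    ⟨⟨f, hf.1.injective⟩, fun {i j} => hf.adj_iff i j⟩ (e' n).symm.toRelEmbedding), fun v => ?_⟩
  have := hlab (e' m v)
  simpa using this

open Set.PartiallyWellOrderedOn in
theorem PermLWQO.of_graphLWQO {C : Set FinPerm} (hC : IsLowerSet C)
    (h : GraphLWQO.{u} (inversionGraphClass C)) : PermLWQO.{u} C := by
  intro L _ _
  rw [Set.IsPWO, iff_not_exists_isMinBadSeq fun p : LabeledPerm L => p.perm.length]
  rintro ⟨f, hf, hmin⟩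
  have hs : IsLowerSet {p : LabeledPerm L | p.perm ∈ C} :=
    fun p q ⟨g, hg, _⟩ hp => hC ⟨g, hg⟩ hp
  have hT := (isPWO_restrict_of_isMinBadSeq hs hf hmin).union (isPWO_length_le_one L)
  set T := {x | ∃ n S, S ≠ Finset.univ ∧ x = (f n).restrict S} ∪
    {p : LabeledPerm L | p.perm.length ≤ 1}
  choose r hr hprop hsimple using fun n => (f n).perm.exists_isIntervalChoice
  have hblock : ∀ n s, (f n).restrict (Finset.univ.filter fun i => r n i = s) ∈ T := by
    intro n s
    rcases hprop n with h | h
    · have h' := (Finset.card_le_univ (Finset.univ.filter fun i => r n i = s)).trans_eq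
        (Fintype.card_fin _)
      exact .inr (h'.trans h)
    · obtain ⟨i, hi⟩ := h s
      exact .inl ⟨n, _, fun hu => hi <| by
        simpa using Finset.ext_iff.1 hu i, rfl⟩
  choose a ha ha' using fun n => exists_marks fun x y : {x // r n x = x} =>
    x < y ∧ (f n).perm.inversionGraph.Adj x y
  choose b hb hb' using fun n => exists_marks fun x y : {x // r n x = x} =>
    x < y ∧ ¬ (f n).perm.inversionGraph.Adj x y
  have : WellQuasiOrderedLE T := ⟨hT⟩
  -- Each representative carries its block, its two edge marks and its two non-edge marks; marks are
  -- ordered by implication, so embeddings carry marked vertices to marked vertices.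
  let G : ℕ → LabeledGraph (T × (Bool → Prop) × (Bool → Prop)) := fun n =>
    ⟨⟨{x // r n x = x}, inferInstance, (f n).perm.inversionGraph.comap Subtype.val⟩,
      fun x => ⟨⟨_, hblock n x⟩, fun i => x ∈ a n i, fun i => x ∈ b n i⟩⟩
  have hG := h (T × (Bool → Prop) × (Bool → Prop))
  rw [Set.IsPWO, Set.partiallyWellOrderedOn_iff_exists_lt] at hG
  obtain ⟨m, n, hmn, g, hg⟩ := hG G fun n => comap_inversionGraph_mem hC (hf.1 n) _
  refine hf.2 m n hmn (LabeledPerm.le_of_graph_embedding (hr m) (hr n) (hsimple m) g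
    (fun x => (hg x).1) (fun h => ?_) fun h => ?_)
  · obtain ⟨x, hx, y, hy, hxy⟩ := ha' m h
    -- The images carry the marks of the target, whose marked pairs are correctly ordered.
    exact ⟨x, y, hxy, (ha n _ _ ((hg x).2.1 false hx) ((hg y).2.1 true hy)).1⟩
  · obtain ⟨x, hx, y, hy, hxy⟩ := hb' m h
    exact ⟨x, y, hxy, (hb n _ _ ((hg x).2.2 false hx) ((hg y).2.2 true hy)).1⟩

theorem mainTheorem1 (C : Set FinPerm) (hC : IsLowerSet C) :
    PermLWQO.{u} C ↔ GraphLWQO.{u} (inversionGraphClass C) :=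
  ⟨GraphLWQO.of_permLWQO, PermLWQO.of_graphLWQO hC⟩
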